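/- Let $d\in\{2,3\}$. An input consists of a matrix $A\in\mathbb{R}^{m\times d}$, $m\ge d+1$, with rows $A_1,\dots,A_m$ such that $P=\{x\mid Ax\le \mathbb 1\}$ is a polytope and $S=\{x\mid A_jx\le 1,\ j\le d+1\}$ is a simplex, and of a tolerance $\varepsilon\ge 0$. For $t\ge 0$ let $tP=\{x\mid Ax\le t\mathbb 1\}$ and likewise $tS$. Both algorithms below compute a graph $G=(V,E)$ with coordinates $c:V\to\mathbb{R}^d$. An algorithm is *correct* in dimension $d$ if for every such input it can start, never gets stuck whatever choices were made before, always terminates, and every output satisfies $$P\subseteq \operatorname{conv} c(V)\subseteq (1+\varepsilon)P .$$ *Common part.* Both algorithms start with $G=K_{d+1}$ on nodes $v_1,\dots,v_{d+1}$, where $c(v_1),\dots,c(v_{d+1})$ are the vertices of $(1+\frac\varepsilon2)S$, numbered such that the inequalities $j\ne i$ of $(1+\frac\varepsilon2)S$ are active at $c(v_i)$. For $i=d+2,\dots,m$ they choose any partition of $V$ into disjoint sets $V_-\neq\emptyset$, $V_0$, $V_+$ with $A_ic(v)<1+\frac\varepsilon2$ on $V_-$, $A_ic(v)>1+\frac\varepsilon2$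 on $V_+$ and $1\le A_ic(v)\le 1+\varepsilon$ on $V_0$. For every edge $uw\in E$ with $u\in V_-$, $w\in V_+$ they add a new node $v=v(u,w)$ to $V_0$ and $V$ and choose for $c(v)$ any point of the segment between $c(u)$ and $c(w)$ with $1\le A_ic(v)\le 1+\varepsilon$. *Approximate double description method.* Incidence sets are initialized by $I(v_i)=\{1,\dots,d+1\}\setminus\{i\}$. In iteration $i$, new nodes get $I(v(u,w))=I(u)\cap I(w)$; then $i$ is added to $I(u)$ for all $u\in V_0$ (including the new nodes), $V_+$ is removed from $V$, and $E$ is replaced by the set of all $uw$ with $u,w\in V$, $u\ne w$ and $|I(u)\cap I(w)|\ge d-1$. *Graph algorithm.* $G$ is a finite plane graph, i.e. embedded into the sphere $S^2$, and each of its faces (components of the complement of the drawing) is either valid or invalid; at the start, exactly one of the two faces is valid if $d=2$, and all four faces are valid if $d=3$. An edge is incident with a face if its arc lies on the frontier of the face. A bounding walk of a face $f$ is a closed walk that uses every edge at most twice, edges used once being incident with $f$ and with another face, edges used twice being incident with $f$ only, and that is maximal with these properties. In iteration $i$, every edge $uw$ with $u\in V_-$, $w\in V_+$ is subdivided by the node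 $v(u,w)$. Then, as long as possible, an edge $u_0w_0$ is inserted into a valid face $f$, where $u_0,w_0\in V_0$, $u_0\ne w_0$, $u_0w_0\notin E$, both $u_0$ and $w_0$ are adjacent to nodes of $V_+$, and there is a walk from $u_0$ to $w_0$ along a bounding walk of $f$ with all intermediate nodes in $V_+$ or with no intermediate node in $V_-$. Finally all edges incident with $V_+$ and the nodes of $V_+$ are removed. Splitting a face gives faces of the same kind, and merging faces gives a valid face if and only if all of these are valid. The output of the graph algorithm is also required to be a plane graph. **Statement.** For $d\in\{2,3\}$: if the graph algorithm is correct in dimension $d$, then the approximate double description method is correct in dimension $d$. Moreover, the approximate double description method is correct in dimension $d$ without any further assumption. -/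

import Mathlib

/-! ## Nondeterministic algorithms and total correctness -/

/-- A (nondeterministic) algorithm on configurations of type `σ`: the possible starting
configurations, the elementary steps, and the configurations in which it has terminated. -/
structure Algorithm (σ : Type) where
  start : σ → Prop
  step : σ → σ → Prop
  halted : σ → Prop

namespace Algorithm

/-- `s` occurs in some execution. -/
def Reachable {σ : Type} (M : Algorithm σ) (s : σ) : Prop :=
  ∃ s₀, M.start s₀ ∧ Relation.ReflTransGen M.step s₀ s

/-- The algorithm is well defined (it can start, it never gets stuck whatever choices have been
made before, and every execution is finite), and every output satisfies `post`. -/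
structure Correct {σ : Type} (M : Algorithm σ) (post : σ → Prop) : Prop where
  can_start : ∃ s, M.start s
  never_stuck : ∀ s, M.Reachable s → ¬ M.halted s → ∃ t, M.step s t
  terminates : ¬ ∃ run : ℕ → σ, M.start (run 0) ∧ ∀ n, M.step (run n) (run (n + 1))
  output : ∀ s, M.Reachable s → M.halted s → post s

end Algorithm

/-! ## The approximate vertex enumeration problem

Rows of `A` are numbered from `0`; the first `d + 1` rows are the rows `i` with `i ≤ d`. -/

namespace ApproxVertexEnum

open Matrix

/-- `{x | A x ≤ t 𝟙}`: the polyhedron `P` for `t = 1`, and `(1 + ε) P` for `t = 1 + ε`. -/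
def polyhedron {m d : ℕ} (A : Matrix (Fin m) (Fin d) ℝ) (t : ℝ) : Set (Fin d → ℝ) :=
  {x | ∀ i : Fin m, A i ⬝ᵥ x ≤ t}

/-- The polyhedron given by the first `d + 1` inequalities: `S` for `t = 1`, and `t S`. -/
def corner {m d : ℕ} (A : Matrix (Fin m) (Fin d) ℝ) (t : ℝ) : Set (Fin d → ℝ) :=
  {x | ∀ i : Fin m, (i : ℕ) ≤ d → A i ⬝ᵥ x ≤ t}

/-- A `d`-simplex in `ℝ^d`. -/
def IsSimplex {d : ℕ} (S : Set (Fin d → ℝ)) : Prop :=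
  ∃ p : Fin (d + 1) → (Fin d → ℝ), AffineIndependent ℝ p ∧ S = convexHull ℝ (Set.range p)

/-- Valid input of both algorithms. -/
structure ValidInput {m d : ℕ} (A : Matrix (Fin m) (Fin d) ℝ) (ε : ℝ) : Prop where
  rows : d + 1 ≤ m
  polytope : Bornology.IsBounded (polyhedron A 1)
  simplex : IsSimplex (corner A 1)
  tolerance : 0 ≤ ε

/-- `conv X` lies between `P` and `(1 + ε) P`. -/
def IsApproxVRep {m d : ℕ} (A : Matrix (Fin m) (Fin d) ℝ) (ε : ℝ) (X : Set (Fin d → ℝ)) : Prop :=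
  polyhedron A 1 ⊆ convexHull ℝ X ∧ convexHull ℝ X ⊆ polyhedron A (1 + ε)

/-- Nodes of the graphs: the nodes `v_0, …, v_d` of the first graph, and the node `v(u, w)` that
iteration `i` creates on the edge `uw`. Nodes of different origin are different, also if they
have the same coordinates. -/
inductive Node (d : ℕ) : Type
  | init (i : Fin (d + 1)) : Node d
  | cut (i : ℕ) (u w : Node d) : Node d

/-- The node set and the edge set of the complete graph `K_{d+1}` the algorithms start with. -/
def initNodes (d : ℕ) : Set (Node d) := Set.range Node.init

def initEdges (d : ℕ) : Set (Sym2 (Node d)) :=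
  {e | ∃ i j : Fin (d + 1), i ≠ j ∧ e = s(Node.init i, Node.init j)}

/-- `u_0, …, u_d` are the vertices of `(1 + ε/2) S`, where `u_i` is the vertex opposite to the
facet of the `i`-th inequality, i.e. the other `d` inequalities of `S` are active at `u_i`. -/
def IsVertexLabelling {m d : ℕ} (A : Matrix (Fin m) (Fin d) ℝ) (ε : ℝ)
    (u : Fin (d + 1) → (Fin d → ℝ)) : Prop :=
  Set.BijOn u Set.univ (Set.extremePoints ℝ (corner A (1 + ε / 2))) ∧
    ∀ (i : Fin (d + 1)) (j : Fin m), (j : ℕ) ≤ d → (j : ℕ) ≠ (i : ℕ) → A j ⬝ᵥ u i = 1 + ε / 2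

/-- The partitions of the node set `V` that are admissible in iteration `i`. -/
structure IsPartition {m d : ℕ} (A : Matrix (Fin m) (Fin d) ℝ) (ε : ℝ) (i : Fin m)
    (V : Set (Node d)) (c : Node d → (Fin d → ℝ)) (Vm V0 Vp : Set (Node d)) : Prop where
  union : Vm ∪ V0 ∪ Vp = V
  disj_m0 : Disjoint Vm V0
  disj_mp : Disjoint Vm Vp
  disj_0p : Disjoint V0 Vp
  nonempty : Vm.Nonempty
  minus : ∀ v ∈ Vm, A i ⬝ᵥ c v < 1 + ε / 2
  plus : ∀ v ∈ Vp, 1 + ε / 2 < A i ⬝ᵥ c v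
  zero : ∀ v ∈ V0, 1 ≤ A i ⬝ᵥ c v ∧ A i ⬝ᵥ c v ≤ 1 + ε

/-- The nodes created in iteration `i`: one on each edge between `V_-` and `V_+`. -/
def newNodes {d : ℕ} (i : ℕ) (E : Set (Sym2 (Node d))) (Vm Vp : Set (Node d)) : Set (Node d) :=
  {v | ∃ u ∈ Vm, ∃ w ∈ Vp, s(u, w) ∈ E ∧ v = Node.cut i u w}

/-- `c'` extends the coordinate function `c` on `V` to the nodes created in iteration `i`. -/
def ExtendsCoords {m d : ℕ} (A : Matrix (Fin m) (Fin d) ℝ) (ε : ℝ) (i : Fin m)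
    (V : Set (Node d)) (E : Set (Sym2 (Node d))) (Vm Vp : Set (Node d))
    (c c' : Node d → (Fin d → ℝ)) : Prop :=
  Set.EqOn c' c V ∧
    ∀ u ∈ Vm, ∀ w ∈ Vp, s(u, w) ∈ E →
      c' (Node.cut i u w) ∈ segment ℝ (c u) (c w) ∧
        1 ≤ A i ⬝ᵥ c' (Node.cut i u w) ∧ A i ⬝ᵥ c' (Node.cut i u w) ≤ 1 + ε

/-! ## The approximate double description method -/

namespace DDM

/-- Graph `(V, E)`, incidence sets `I` and coordinates `c` (the values of `I` and `c` outside `V`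
are irrelevant). -/
structure State (d : ℕ) where
  V : Set (Node d)
  E : Set (Sym2 (Node d))
  I : Node d → Finset ℕ
  c : Node d → (Fin d → ℝ)

/-- `ready k s`: the iterations of the rows before `k` are finished. `split k s Vm V0 Vp`: the
partition has been chosen in the iteration of row `k`. -/
inductive Config (d : ℕ) : Type
  | ready (k : ℕ) (s : State d) : Config d
  | split (k : ℕ) (s : State d) (Vm V0 Vp : Set (Node d)) : Config d

structure IsInitial {m d : ℕ} (A : Matrix (Fin m) (Fin d) ℝ) (ε : ℝ) (s : State d) : Prop where
  nodes : s.V = initNodes d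
  edges : s.E = initEdges d
  incidence : ∀ i : Fin (d + 1), s.I (Node.init i) = (Finset.range (d + 1)).erase i
  coords : IsVertexLabelling A ε (fun i => s.c (Node.init i))

/-- The part of iteration `i` after the choice of the partition. -/
structure Update {m d : ℕ} (A : Matrix (Fin m) (Fin d) ℝ) (ε : ℝ) (i : Fin m)
    (s : State d) (Vm V0 Vp : Set (Node d)) (s' : State d) : Prop where
  coords : ExtendsCoords A ε i s.V s.E Vm Vp s.c s'.c
  inc_minus : ∀ v ∈ Vm, s'.I v = s.I v
  inc_zero : ∀ v ∈ V0, s'.I v = insert (i : ℕ) (s.I v)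
  inc_new : ∀ u ∈ Vm, ∀ w ∈ Vp, s(u, w) ∈ s.E →
    s'.I (Node.cut i u w) = insert (i : ℕ) (s.I u ∩ s.I w)
  nodes : s'.V = Vm ∪ V0 ∪ newNodes i s.E Vm Vp
  edges : s'.E = {e | ∃ u ∈ s'.V, ∃ w ∈ s'.V,
    u ≠ w ∧ e = s(u, w) ∧ d - 1 ≤ (s'.I u ∩ s'.I w).card}

inductive Step {m d : ℕ} (A : Matrix (Fin m) (Fin d) ℝ) (ε : ℝ) : Config d → Config d → Prop
  | partition (i : Fin m) (s : State d) (Vm V0 Vp : Set (Node d)) :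
      IsPartition A ε i s.V s.c Vm V0 Vp → Step A ε (.ready i s) (.split i s Vm V0 Vp)
  | update (i : Fin m) (s s' : State d) (Vm V0 Vp : Set (Node d)) :
      Update A ε i s Vm V0 Vp s' → Step A ε (.split i s Vm V0 Vp) (.ready (i + 1) s')

/-- The approximate double description method with input `A`, `ε`. -/
def algorithm {m d : ℕ} (A : Matrix (Fin m) (Fin d) ℝ) (ε : ℝ) : Algorithm (Config d) where
  start x := ∃ s, IsInitial A ε s ∧ x = .ready (d + 1) s
  step := Step A ε
  halted x := ∃ s, x = .ready m s

/-- Correctness of the approximate double description method in dimension `d`. -/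
def Correct (d : ℕ) : Prop :=
  ∀ (m : ℕ) (A : Matrix (Fin m) (Fin d) ℝ) (ε : ℝ), ValidInput A ε →
    (algorithm A ε).Correct (fun x => ∀ s, x = .ready m s → IsApproxVRep A ε (s.c '' s.V))

end DDM

/-! ## Plane graphs -/

/-- The sphere `S²`. -/
abbrev Sphere2 : Type := Metric.sphere (0 : EuclideanSpace ℝ (Fin 3)) 1

/-- A graph with nodes in `α`, drawn on the sphere: `pt v` is the position of the node `v`, and
`arc e` is the curve that represents the edge `e` (values outside `V` and `E` are irrelevant). -/
structure Drawing (α : Type) where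
  V : Set α
  E : Set (Sym2 α)
  pt : α → Sphere2
  arc : Sym2 α → Set Sphere2

namespace Drawing

variable {α : Type}

/-- The points of the two ends of an edge. -/
def ends (G : Drawing α) (e : Sym2 α) : Set Sphere2 := G.pt '' {x | x ∈ e}

/-- The drawing is a (finite) plane graph. -/
structure IsPlane (G : Drawing α) : Prop where
  finite : G.V.Finite
  loopless : ∀ e ∈ G.E, ¬ e.IsDiag
  incident : ∀ e ∈ G.E, ∀ x ∈ e, x ∈ G.V
  pt_inj : Set.InjOn G.pt G.V
  isArc : ∀ u w, s(u, w) ∈ G.E →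
    ∃ γ : Path (G.pt u) (G.pt w), Function.Injective γ ∧ Set.range γ = G.arc s(u, w)
  no_node : ∀ e ∈ G.E, ∀ x ∈ G.V, G.pt x ∉ G.arc e \ G.ends e
  no_cross : ∀ e ∈ G.E, ∀ e' ∈ G.E, e ≠ e' → Disjoint (G.arc e \ G.ends e) (G.arc e')

/-- The set of points of the sphere covered by the drawing. -/
def support (G : Drawing α) : Set Sphere2 := G.pt '' G.V ∪ ⋃ e ∈ G.E, G.arc e

/-- The faces: the connected components of the complement of the drawing. -/
def faces (G : Drawing α) : Set (Set Sphere2) :=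
  {f | ∃ x ∈ G.supportᶜ, f = connectedComponentIn G.supportᶜ x}

/-- The edge `e` is incident with the face `f`. -/
def Incident (G : Drawing α) (e : Sym2 α) (f : Set Sphere2) : Prop := G.arc e ⊆ frontier f

/-- The underlying abstract graph. -/
def graph (G : Drawing α) : SimpleGraph α := SimpleGraph.fromEdgeSet G.E

open Classical in
/-- Conditions (i), (ii), (iii) on a bounding walk of `f`: no edge occurs more than twice, an edge
that occurs once is incident with `f` and another face, an edge that occurs twice is incident
with `f` only. -/
structure IsPreBounding (G : Drawing α) (f : Set Sphere2) {v : α} (W : G.graph.Walk v v) :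
    Prop where
  twice : ∀ e, W.edges.count e ≤ 2
  once : ∀ e, W.edges.count e = 1 → G.Incident e f ∧ ∃ f' ∈ G.faces, f' ≠ f ∧ G.Incident e f'
  only : ∀ e, W.edges.count e = 2 → G.Incident e f ∧ ∀ f' ∈ G.faces, G.Incident e f' → f' = f

/-- `W` is a bounding walk of the face `f`: a closed walk that is maximal with (i), (ii), (iii).
Whether a closed walk has this property depends neither on the node where it starts nor on its
direction. -/
def IsBoundingWalk (G : Drawing α) (f : Set Sphere2) {v : α} (W : G.graph.Walk v v) : Prop :=
  f ∈ G.faces ∧ G.IsPreBounding f W ∧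
    ∀ (v' : α) (W' : G.graph.Walk v' v'), G.IsPreBounding f W' →
      (W.edges : Multiset (Sym2 α)) ≤ (W'.edges : Multiset (Sym2 α)) →
      (W.edges : Multiset (Sym2 α)) = (W'.edges : Multiset (Sym2 α))

/-- There is a walk along a bounding walk of `f` from `u` to `w` with all intermediate nodes in
`Vp`, or with no intermediate node in `Vm`. -/
def Joined (G : Drawing α) (Vm Vp : Set α) (f : Set Sphere2) (u w : α) : Prop :=
  ∃ (p : G.graph.Walk u w) (q : G.graph.Walk w u), G.IsBoundingWalk f (p.append q) ∧
    ((∀ x ∈ p.support.tail.dropLast, x ∈ Vp) ∨ (∀ x ∈ p.support.tail.dropLast, x ∉ Vm))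

end Drawing

/-! ## The graph algorithm -/

namespace GA

/-- Plane graph, coordinates, and the set of those faces that are valid. -/
structure State (d : ℕ) extends Drawing (Node d) where
  c : Node d → (Fin d → ℝ)
  valid : Set (Set Sphere2)

/-- `ready k s`: the iterations of the rows before `k` are finished. `split k s Vm V0 Vp`: the
partition has been chosen in the iteration of row `k`. `insert k s Vm V0 Vp`: the edges between
`V_-` and `V_+` have been subdivided, and edges inside faces are being inserted. -/
inductive Config (d : ℕ) : Type
  | ready (k : ℕ) (s : State d) : Config d
  | split (k : ℕ) (s : State d) (Vm V0 Vp : Set (Node d)) : Config d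
  | insert (k : ℕ) (s : State d) (Vm V0 Vp : Set (Node d)) : Config d

/-- `K_{d+1}` drawn on the sphere; one of the two faces is valid if `d = 2`, and all four faces
are valid if `d = 3`. -/
structure IsInitial {m d : ℕ} (A : Matrix (Fin m) (Fin d) ℝ) (ε : ℝ) (s : State d) : Prop where
  nodes : s.V = initNodes d
  edges : s.E = initEdges d
  plane : s.toDrawing.IsPlane
  coords : IsVertexLabelling A ε (fun i => s.c (Node.init i))
  valid_two : d = 2 → ∃ f ∈ s.faces, s.valid = {f}
  valid_three : d = 3 → s.valid = s.faces

/-- First inner loop: every edge `uw` with `u ∈ V_-` and `w ∈ V_+` is subdivided by a new node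
`v(u, w)` placed in the interior of its arc. This does not change the faces. -/
structure Subdivide {m d : ℕ} (A : Matrix (Fin m) (Fin d) ℝ) (ε : ℝ) (i : Fin m)
    (s : State d) (Vm Vp : Set (Node d)) (s' : State d) : Prop where
  plane : s'.toDrawing.IsPlane
  nodes : s'.V = s.V ∪ newNodes i s.E Vm Vp
  edges : s'.E = {e ∈ s.E | ¬ ∃ u ∈ Vm, ∃ w ∈ Vp, e = s(u, w)} ∪
    {e | ∃ u ∈ Vm, ∃ w ∈ Vp, s(u, w) ∈ s.E ∧
      (e = s(u, Node.cut i u w) ∨ e = s(Node.cut i u w, w))}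
  pt_old : Set.EqOn s'.pt s.pt s.V
  arc_old : ∀ e ∈ s.E, e ∈ s'.E → s'.arc e = s.arc e
  arc_new : ∀ u ∈ Vm, ∀ w ∈ Vp, s(u, w) ∈ s.E →
    s'.arc s(u, Node.cut i u w) ∪ s'.arc s(Node.cut i u w, w) = s.arc s(u, w)
  coords : ExtendsCoords A ε i s.V s.E Vm Vp s.c s'.c
  valid : s'.valid = s.valid

/-- `u` and `w` satisfy the conditions of the second inner loop for the insertion of an edge into
the face `f`. -/
structure CanInsert {d : ℕ} (s : State d) (Vm V0 Vp : Set (Node d)) (f : Set Sphere2)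
    (u w : Node d) : Prop where
  left_zero : u ∈ V0
  right_zero : w ∈ V0
  ne : u ≠ w
  not_edge : s(u, w) ∉ s.E
  left_plus : ∃ x ∈ Vp, s(u, x) ∈ s.E
  right_plus : ∃ x ∈ Vp, s(w, x) ∈ s.E
  valid : f ∈ s.valid
  joined : s.Joined Vm Vp f u w

/-- The edge `uw` is inserted into the face `f`. Faces that arise by splitting a face are valid
if and only if that face was valid. -/
structure InsertEdge {d : ℕ} (s : State d) (f : Set Sphere2) (u w : Node d) (s' : State d) :
    Prop where
  plane : s'.toDrawing.IsPlane
  nodes : s'.V = s.V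
  edges : s'.E = s.E ∪ {s(u, w)}
  pt_old : Set.EqOn s'.pt s.pt s.V
  arc_old : Set.EqOn s'.arc s.arc s.E
  arc_new : s'.arc s(u, w) ⊆ f ∪ {s.pt u, s.pt w}
  coords : Set.EqOn s'.c s.c s.V
  valid : s'.valid = {g ∈ s'.faces | ∃ g₀ ∈ s.valid, g ⊆ g₀}

/-- The nodes of `V_+` and the edges incident with them are removed. A face that arises by merging
faces is valid if and only if all of these were valid. -/
structure Remove {d : ℕ} (s : State d) (Vp : Set (Node d)) (s' : State d) : Prop where
  plane : s'.toDrawing.IsPlane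
  nodes : s'.V = s.V \ Vp
  edges : s'.E = {e ∈ s.E | ∀ x ∈ e, x ∉ Vp}
  pt_old : Set.EqOn s'.pt s.pt s'.V
  arc_old : Set.EqOn s'.arc s.arc s'.E
  coords : Set.EqOn s'.c s.c s'.V
  valid : s'.valid = {g ∈ s'.faces | ∀ g₀ ∈ s.faces, g₀ ⊆ g → g₀ ∈ s.valid}

inductive Step {m d : ℕ} (A : Matrix (Fin m) (Fin d) ℝ) (ε : ℝ) : Config d → Config d → Prop
  | partition (i : Fin m) (s : State d) (Vm V0 Vp : Set (Node d)) :
      IsPartition A ε i s.V s.c Vm V0 Vp → Step A ε (.ready i s) (.split i s Vm V0 Vp)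
  | subdivide (i : Fin m) (s s' : State d) (Vm V0 Vp : Set (Node d)) :
      Subdivide A ε i s Vm Vp s' →
      Step A ε (.split i s Vm V0 Vp) (.insert i s' Vm (V0 ∪ newNodes i s.E Vm Vp) Vp)
  | insertEdge (i : Fin m) (s s' : State d) (Vm V0 Vp : Set (Node d)) (f : Set Sphere2)
      (u w : Node d) :
      CanInsert s Vm V0 Vp f u w → InsertEdge s f u w s' →
      Step A ε (.insert i s Vm V0 Vp) (.insert i s' Vm V0 Vp)
  | remove (i : Fin m) (s s' : State d) (Vm V0 Vp : Set (Node d)) :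
      (¬ ∃ f u w, CanInsert s Vm V0 Vp f u w) → Remove s Vp s' →
      Step A ε (.insert i s Vm V0 Vp) (.ready (i + 1) s')

/-- The graph algorithm with input `A`, `ε`. -/
def algorithm {m d : ℕ} (A : Matrix (Fin m) (Fin d) ℝ) (ε : ℝ) : Algorithm (Config d) where
  start x := ∃ s, IsInitial A ε s ∧ x = .ready (d + 1) s
  step := Step A ε
  halted x := ∃ s, x = .ready m s

/-- Correctness of the graph algorithm in dimension `d` (`d = 2` or `d = 3`). -/
def Correct (d : ℕ) : Prop :=
  ∀ (m : ℕ) (A : Matrix (Fin m) (Fin d) ℝ) (ε : ℝ), ValidInput A ε →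
    (algorithm A ε).Correct
      (fun x => ∀ s, x = .ready m s → s.toDrawing.IsPlane ∧ IsApproxVRep A ε (s.c '' s.V))

end GA

end ApproxVertexEnum

/-! The content is the unconditional correctness of the double description method; the argument
works in every dimension. The delicate claim is `P ⊆ conv c(V)`, since a row `j ∈ I(v)` is only
known to satisfy `1 ≤ A_j c(v)`.

If a set `T` of row indices lies in `I(v)` and `h` is in the cone of the rows in `T`, then `h x ≤ h
c(v)` for all `x ∈ P`. A functional separating `x` from `conv c(V)` can be chosen generic, so it
suffices that such cones cover all generic `h` (`OddCover.mem_convexHull`).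

The iterations preserve a parity version: some cycle `z` modulo two of `d`-sets `T ⊆ I(v)` covers
each generic `h` an odd number of times (`OddCover`). At the start `z` is the boundary of the
simplex on the first `d + 1` rows. In iteration `i` let `z = z₋ + z₊`, where `z₊` consists of sets
available only at `V_+`, and replace `z₊` by the cone with apex `i` over `∂z₊` (`OddCover.insert`).
This adds boundaries of simplices `T ∪ {i}` whose rows are all positive at one point, and these
cover generic directions evenly (`Generic.sum_inCone_eq_zero`). Because `∂z₋ = ∂z₊`, each
`(d-1)`-set `e` involved lies in `I(u) ∩ I(w)` with `u ∈ V_- ∪ V_0` and `w ∈ V_+`. If `u ∈ V_-`,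
then `uw` is an edge and its new node carries `e ∪ {i}`; if `u ∈ V_0`, then `u` itself does. -/

namespace ApproxVertexEnum

open Matrix

/-! ## Chains of index sets modulo two -/

/-- Formal sums of index sets with coefficients modulo two. -/
abbrev IndexChain : Type := Finset ℕ →₀ ZMod 2

namespace IndexChain

/-- The simplicial boundary. -/
noncomputable def boundary : IndexChain →ₗ[ZMod 2] IndexChain :=
  Finsupp.linearCombination (ZMod 2) fun T => ∑ j ∈ T, Finsupp.single (T.erase j) 1

/-- The cone with apex `i`. -/
noncomputable def cone (i : ℕ) : IndexChain →ₗ[ZMod 2] IndexChain :=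
  Finsupp.lmapDomain (ZMod 2) (ZMod 2) (insert i)

lemma boundary_single (T : Finset ℕ) :
    boundary (Finsupp.single T 1) = ∑ j ∈ T, Finsupp.single (T.erase j) 1 := by
  simp [boundary]

lemma cone_single (i : ℕ) (T : Finset ℕ) (r : ZMod 2) :
    cone i (Finsupp.single T r) = Finsupp.single (insert i T) r := by
  simp [cone]

lemma add_self (z : IndexChain) : z + z = 0 := by
  ext T
  exact CharTwo.add_self_eq_zero _

lemma eq_sum (z : IndexChain) : z = ∑ T ∈ z.support, z T • Finsupp.single T (1 : ZMod 2) := by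
  conv_lhs => rw [← Finsupp.sum_single z]
  simp [Finsupp.sum]

lemma boundary_boundary (z : IndexChain) : boundary (boundary z) = 0 := by
  have key : ∀ T : Finset ℕ, boundary (boundary (Finsupp.single T 1)) = 0 := by
    intro T
    rw [boundary_single, map_sum]
    simp_rw [boundary_single]
    rw [Finset.sum_sigma']
    -- Removing `j` and `l` in either order gives the same set, so the terms cancel in pairs.
    refine Finset.sum_involution (fun x _ => ⟨x.2, x.1⟩) ?_ ?_ ?_ ?_
    · rintro ⟨j, l⟩ _
      rw [Finset.erase_right_comm]
      exact add_self _
    · rintro ⟨j, l⟩ h _ h'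
      simp only [Finset.mem_sigma, Finset.mem_erase] at h
      simp only [Sigma.mk.injEq] at h'
      exact h.2.1 h'.1
    · rintro ⟨j, l⟩ h
      simp only [Finset.mem_sigma, Finset.mem_erase] at h ⊢
      exact ⟨h.2.2, Ne.symm h.2.1, h.1⟩
    · rintro ⟨j, l⟩ _
      rfl
  rw [eq_sum z]
  simp only [map_sum, map_smul, key, smul_zero, Finset.sum_const_zero]

/-- Erasing the apex returns the base, erasing any other index gives a cone over a face. An index
set already containing `i` would not be enlarged, hence the restriction on `z`. -/
lemma boundary_cone (i : ℕ) (z : IndexChain) (hz : ∀ T ∈ z.support, i ∉ T) :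
    boundary (cone i z) = z + cone i (boundary z) := by
  have key : ∀ T : Finset ℕ, i ∉ T → boundary (cone i (Finsupp.single T 1)) =
      Finsupp.single T 1 + cone i (boundary (Finsupp.single T 1)) := by
    intro T hT
    rw [cone_single, boundary_single, boundary_single, Finset.sum_insert hT,
      Finset.erase_insert hT, map_sum]
    congr 1
    refine Finset.sum_congr rfl fun j hj => ?_
    rw [cone_single, Finset.erase_insert_of_ne]
    rintro rfl
    exact hT hj
  conv_lhs => rw [eq_sum z]
  conv_rhs => rw [eq_sum z]
  simp only [map_sum, map_smul]
  rw [← Finset.sum_add_distrib]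
  refine Finset.sum_congr rfl fun T hT => ?_
  rw [key T (hz T hT), smul_add]

lemma exists_of_mem_support_boundary {z : IndexChain} {e : Finset ℕ}
    (he : e ∈ (boundary z).support) : ∃ T ∈ z.support, ∃ j ∈ T, e = T.erase j := by
  classical
  by_contra! H
  rw [Finsupp.mem_support_iff] at he
  apply he
  conv_lhs => rw [eq_sum z]
  simp only [map_sum, map_smul, boundary_single, Finsupp.finsetSum_apply, Finsupp.smul_apply]
  refine Finset.sum_eq_zero fun T hT => ?_
  rw [Finset.sum_eq_zero, smul_zero]
  intro j hj
  exact Finsupp.single_eq_of_ne (H T hT j hj)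

lemma exists_of_mem_support_cone {i : ℕ} {z : IndexChain} {T : Finset ℕ}
    (hT : T ∈ (cone i z).support) : ∃ e ∈ z.support, T = insert i e := by
  classical
  have h : T ∈ z.support.image (insert i) := Finsupp.mapDomain_support hT
  obtain ⟨e, he, rfl⟩ := Finset.mem_image.1 h
  exact ⟨e, he, rfl⟩

end IndexChain

/-! ## Cones spanned by rows -/

section Cones

variable {d : ℕ} {a : ℕ → Fin d → ℝ} {h : Fin d → ℝ} {σ : Finset ℕ}

/-- `h` lies in the convex cone generated by the vectors `a j`, `j ∈ T`. -/
def InCone (a : ℕ → Fin d → ℝ) (h : Fin d → ℝ) (T : Finset ℕ) : Prop :=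
  ∃ l : ℕ → ℝ, (∀ j ∈ T, 0 ≤ l j) ∧ ∑ j ∈ T, l j • a j = h

/-- `h` is not spanned by fewer than `d` of the vectors `a j`. -/
def Generic (a : ℕ → Fin d → ℝ) (h : Fin d → ℝ) : Prop :=
  ∀ J : Finset ℕ, J.card < d → h ∉ Submodule.span ℝ (a '' (J : Set ℕ))

/-- Puts the cones of all facets of `σ` on the same footing, as coefficient vectors on `σ` with one
zero. -/
lemma inCone_erase_iff {p : ℕ} (hp : p ∈ σ) : InCone a h (σ.erase p) ↔
    ∃ l : ℕ → ℝ, (∀ j ∈ σ, 0 ≤ l j) ∧ l p = 0 ∧ ∑ j ∈ σ, l j • a j = h := by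
  constructor
  · rintro ⟨l, h0, h1⟩
    refine ⟨Function.update l p 0, fun j hj => ?_, by simp, ?_⟩
    · by_cases hjp : j = p
      · simp [hjp]
      · rw [Function.update_of_ne hjp]
        exact h0 j (Finset.mem_erase.2 ⟨hjp, hj⟩)
    · rw [← Finset.add_sum_erase _ _ hp, ← h1]
      simp only [Function.update_self, zero_smul, zero_add]
      refine Finset.sum_congr rfl fun j hj => ?_
      rw [Function.update_of_ne (Finset.ne_of_mem_erase hj)]
  · rintro ⟨l, h0, hp0, h1⟩
    refine ⟨l, fun j hj => h0 j (Finset.mem_of_mem_erase hj), ?_⟩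
    rw [← Finset.add_sum_erase _ _ hp, hp0] at h1
    simpa using h1

/-- Two vanishing coefficients would leave `h` in the span of `d - 1` vectors. -/
lemma Generic.zero_unique (hg : Generic a h) (hσ : σ.card = d + 1) {l : ℕ → ℝ}
    (hl : ∑ j ∈ σ, l j • a j = h) {p q : ℕ} (hp : p ∈ σ) (hq : q ∈ σ) (lp : l p = 0)
    (lq : l q = 0) : p = q := by
  by_contra hpq
  have hq' : q ∈ σ.erase p := Finset.mem_erase.2 ⟨Ne.symm hpq, hq⟩
  refine hg ((σ.erase p).erase q) ?_ ?_
  · have h1 := Finset.card_erase_add_one hp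
    have h2 := Finset.card_erase_add_one hq'
    omega
  · rw [← hl, ← Finset.add_sum_erase _ _ hp, ← Finset.add_sum_erase _ _ hq', lp, lq]
    simp only [zero_smul, zero_add]
    exact Submodule.sum_mem _ fun j hj =>
      Submodule.smul_mem _ _ (Submodule.subset_span ⟨j, hj, rfl⟩)

lemma sum_add_smul {l μ : ℕ → ℝ} (hl : ∑ j ∈ σ, l j • a j = h)
    (hμ : ∑ j ∈ σ, μ j • a j = 0) (t : ℝ) : ∑ j ∈ σ, (l j + t * μ j) • a j = h := by
  simp only [add_smul, mul_smul, Finset.sum_add_distrib, ← Finset.smul_sum, hμ, hl, smul_zero,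
    add_zero]

lemma Generic.relation_eq_zero (hg : Generic a h) (hσ : σ.card = d + 1) {l μ : ℕ → ℝ}
    (hl : ∑ j ∈ σ, l j • a j = h) (hμ : ∑ j ∈ σ, μ j • a j = 0) {p : ℕ} (hp : p ∈ σ)
    (lp : l p = 0) (μp : μ p = 0) {q : ℕ} (hq : q ∈ σ) : μ q = 0 := by
  by_contra hne
  have := hg.zero_unique hσ (sum_add_smul hl hμ (-(l q) / μ q)) hp hq (by simp [lp, μp])
    (by field_simp; ring)
  subst this
  exact hne μp

/-- The representations of `h` on `σ` form a line with direction `μ`: after subtracting the right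
multiple of `μ`, the difference of two of them vanishes at `p`, hence everywhere. -/
lemma Generic.eq_add_smul (hg : Generic a h) (hσ : σ.card = d + 1) {l l' μ : ℕ → ℝ}
    (hl : ∑ j ∈ σ, l j • a j = h) (hl' : ∑ j ∈ σ, l' j • a j = h)
    (hμ : ∑ j ∈ σ, μ j • a j = 0) {p : ℕ} (hp : p ∈ σ) (lp : l p = 0) (μp : μ p ≠ 0)
    {q : ℕ} (hq : q ∈ σ) : l' q = l q + l' p / μ p * μ q := by
  have h0 : ∑ j ∈ σ, (l' j - l j) • a j = 0 := by
    simp only [sub_smul, Finset.sum_sub_distrib, hl, hl', sub_self]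
  have := hg.relation_eq_zero hσ hl (sum_add_smul h0 hμ (-(l' p / μ p))) hp lp
    (by rw [lp]; field_simp; ring) hq
  linarith

lemma exists_relation (a : ℕ → Fin d → ℝ) (hσ : σ.card = d + 1) :
    ∃ μ : ℕ → ℝ, ∑ j ∈ σ, μ j • a j = 0 ∧ ∃ p ∈ σ, μ p ≠ 0 := by
  by_contra! H
  have hi : LinearIndepOn ℝ a (σ : Set ℕ) := by
    rw [linearIndepOn_finset_iff]
    exact fun μ hμ p hp => H μ hμ p hp
  have := LinearIndependent.fintype_card_le_finrank hi
  simp at this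
  omega

open Classical in
-- The nonnegative representations of `h` form an interval on the line `l + tμ`. The vector `w`
-- forces `μ` to change sign, so a nonempty interval is bounded. By genericity each of its two ends
-- lies in exactly one facet cone, so the count is 0 or 2.
lemma Generic.sum_inCone_eq_zero (hg : Generic a h) (hσ : σ.card = d + 1) {w : Fin d → ℝ}
    (hw : ∀ j ∈ σ, 0 < a j ⬝ᵥ w) :
    ∑ j ∈ σ, (if InCone a h (σ.erase j) then 1 else 0 : ZMod 2) = 0 := by
  rw [Finset.sum_boole]
  rcases Finset.eq_empty_or_nonempty (σ.filter fun j => InCone a h (σ.erase j)) with he | ⟨p, hp⟩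
  · simp [he]
  obtain ⟨hp, hc⟩ := Finset.mem_filter.1 hp
  obtain ⟨l, l0, lp, hl⟩ := (inCone_erase_iff hp).1 hc
  obtain ⟨μ, hμ, μp⟩ : ∃ μ : ℕ → ℝ, ∑ j ∈ σ, μ j • a j = 0 ∧ 0 < μ p := by
    obtain ⟨μ, hμ, q, hq, μq⟩ := exists_relation a hσ
    have μp : μ p ≠ 0 := fun h0 => μq (hg.relation_eq_zero hσ hl hμ hp lp h0 hq)
    refine ⟨fun j => μ p * μ j, ?_, mul_self_pos.2 μp⟩
    simp only [mul_smul, ← Finset.smul_sum, hμ, smul_zero]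
  have hneg : (σ.filter fun j => μ j < 0).Nonempty := by
    by_contra hemp
    have hnn : ∀ j ∈ σ, 0 ≤ μ j := by
      intro j hj
      by_contra hlt
      exact hemp ⟨j, Finset.mem_filter.2 ⟨hj, not_le.1 hlt⟩⟩
    have h1 : ∑ j ∈ σ, μ j * (a j ⬝ᵥ w) = 0 := by
      have := congrArg (fun v => v ⬝ᵥ w) hμ
      simpa [sum_dotProduct, smul_dotProduct] using this
    have h2 : 0 < ∑ j ∈ σ, μ j * (a j ⬝ᵥ w) :=
      Finset.sum_pos' (fun j hj => mul_nonneg (hnn j hj) (hw j hj).le)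
        ⟨p, hp, mul_pos μp (hw p hp)⟩
    exact h2.ne' h1
  -- Ratio test: `q` is the coefficient that vanishes first as `t` grows from `0`, where `p`
  -- vanishes.
  obtain ⟨q, hq, hmin⟩ := Finset.exists_min_image _ (fun j => l j / (-μ j)) hneg
  obtain ⟨hq, μq⟩ := Finset.mem_filter.1 hq
  have hqp : q ≠ p := by rintro rfl; exact lt_asymm μq μp
  set t := l q / (-μ q) with ht
  have t0 : 0 ≤ t := div_nonneg (l0 q hq) (by linarith)
  have hlq : l q + t * μ q = 0 := by
    have := μq.ne
    rw [ht]; field_simp; ring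
  have hl'0 : ∀ j ∈ σ, 0 ≤ l j + t * μ j := by
    intro j hj
    rcases le_or_gt 0 (μ j) with hj0 | hj0
    · exact add_nonneg (l0 j hj) (mul_nonneg t0 hj0)
    · have := hmin j (Finset.mem_filter.2 ⟨hj, hj0⟩)
      rw [le_div_iff₀ (by linarith)] at this
      linarith
  have hset : (σ.filter fun j => InCone a h (σ.erase j)) = {p, q} := by
    ext r
    simp only [Finset.mem_filter, Finset.mem_insert, Finset.mem_singleton]
    constructor
    · rintro ⟨hr, hrc⟩
      obtain ⟨k, k0, kr, hk⟩ := (inCone_erase_iff hr).1 hrc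
      by_cases hrp : r = p
      · exact Or.inl hrp
      right
      have hkeq : ∀ j ∈ σ, k j = l j + k p / μ p * μ j := fun j hj =>
        hg.eq_add_smul hσ hl hk hμ hp lp μp.ne' hj
      set s := k p / μ p with hs
      have s0 : 0 ≤ s := div_nonneg (k0 p hp) μp.le
      have e1 := hkeq r hr
      have lr : 0 < l r := lt_of_le_of_ne (l0 r hr) fun h0 =>
        hrp (hg.zero_unique hσ hl hr hp h0.symm lp)
      have μr : μ r < 0 := by
        by_contra hnn
        have := mul_nonneg s0 (not_lt.1 hnn)
        linarith
      have hst : t ≤ s := by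
        have := hl'0 r hr
        nlinarith
      have hts : s ≤ t := by
        have := k0 q hq
        rw [hkeq q hq] at this
        nlinarith
      have hst' : s = t := le_antisymm hts hst
      refine hg.zero_unique hσ hk hr hq kr ?_
      rw [hkeq q hq, hst', hlq]
    · rintro (rfl | rfl)
      · exact ⟨hp, hc⟩
      · exact ⟨hq, (inCone_erase_iff hq).2 ⟨_, hl'0, hlq, sum_add_smul hl hμ t⟩⟩
  rw [hset, Finset.card_pair hqp.symm]
  rfl

open Classical in
-- With `μ` positive, the nonnegative part of the line `l + tμ` is a ray, which has a single end.
lemma Generic.sum_inCone_eq_one (hg : Generic a h) (hσ : σ.card = d + 1) {l μ : ℕ → ℝ}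
    (hl : ∑ j ∈ σ, l j • a j = h) (hμ : ∑ j ∈ σ, μ j • a j = 0) (μ0 : ∀ j ∈ σ, 0 < μ j) :
    ∑ j ∈ σ, (if InCone a h (σ.erase j) then 1 else 0 : ZMod 2) = 1 := by
  rw [Finset.sum_boole]
  have hne : σ.Nonempty := Finset.card_pos.1 (by omega)
  obtain ⟨p, hp, hmin⟩ := Finset.exists_min_image σ (fun j => l j / μ j) hne
  set t := -(l p / μ p) with ht
  have hkp : l p + t * μ p = 0 := by
    have := (μ0 p hp).ne'
    rw [ht]; field_simp; ring
  have hk0 : ∀ j ∈ σ, 0 ≤ l j + t * μ j := by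
    intro j hj
    have := hmin j hj
    rw [le_div_iff₀ (μ0 j hj)] at this
    linarith
  have hset : (σ.filter fun j => InCone a h (σ.erase j)) = {p} := by
    ext r
    simp only [Finset.mem_filter, Finset.mem_singleton]
    constructor
    · rintro ⟨hr, hrc⟩
      obtain ⟨k, k0, kr, hk⟩ := (inCone_erase_iff hr).1 hrc
      have e := fun j hj => hg.eq_add_smul hσ (sum_add_smul hl hμ t) hk hμ hp hkp (μ0 p hp).ne'
        (q := j) hj
      have s0 : 0 ≤ k p / μ p := div_nonneg (k0 p hp) (μ0 p hp).le
      have h1 := mul_nonneg s0 (μ0 r hr).le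
      have h2 := e r hr
      have h3 := hk0 r hr
      exact hg.zero_unique hσ (sum_add_smul hl hμ t) hr hp (by linarith) hkp
    · rintro rfl
      exact ⟨hp, (inCone_erase_iff hp).2 ⟨_, hk0, hkp, sum_add_smul hl hμ t⟩⟩
  rw [hset]
  simp

open Classical in
/-- The parity of the number of index sets in a chain whose cones contain `h`. -/
noncomputable def coneParity (a : ℕ → Fin d → ℝ) (h : Fin d → ℝ) : IndexChain →ₗ[ZMod 2] ZMod 2 :=
  Finsupp.linearCombination (ZMod 2) fun T => if InCone a h T then 1 else 0

open Classical in
lemma coneParity_boundary_single (T : Finset ℕ) :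
    coneParity a h (IndexChain.boundary (Finsupp.single T 1)) =
      ∑ j ∈ T, (if InCone a h (T.erase j) then 1 else 0 : ZMod 2) := by
  rw [IndexChain.boundary_single, map_sum]
  simp [coneParity]

/-- A cycle of `d`-sets with property `F` whose cones cover every generic direction an odd number
of times. -/
def OddCover (a : ℕ → Fin d → ℝ) (F : Finset ℕ → Prop) : Prop :=
  ∃ z : IndexChain, IndexChain.boundary z = 0 ∧ (∀ T ∈ z.support, T.card = d ∧ F T) ∧
    ∀ h, Generic a h → coneParity a h z = 1

lemma OddCover.exists_inCone {F : Finset ℕ → Prop} (H : OddCover a F) (hg : Generic a h) :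
    ∃ T, F T ∧ InCone a h T := by
  obtain ⟨z, -, hF, hz⟩ := H
  by_contra! hcon
  have h1 := hz h hg
  rw [IndexChain.eq_sum z, map_sum, Finset.sum_eq_zero] at h1
  · exact zero_ne_one h1
  · intro T hT
    simp [coneParity, hcon T (hF T hT).2]

/-- One iteration on the level of chains: `Fm` describes the sets at kept nodes, `Fp` those at
removed nodes. The new cycle differs from the old one by the boundary of `cone i zp`, which has even
parity. -/
lemma OddCover.insert {F Fm Fp F' : Finset ℕ → Prop} (H : OddCover a F) (i : ℕ)
    (hF : ∀ T, F T → Fm T ∨ Fp T) (hi : ∀ T, F T → i ∉ T)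
    (hpos : ∀ T, Fp T → ∃ w : Fin d → ℝ, ∀ j ∈ insert i T, 0 < a j ⬝ᵥ w)
    (hm : ∀ T, Fm T → F' T)
    (hnew : ∀ T T' e, Fm T → Fp T' → e ⊆ T → e ⊆ T' → e.card + 1 = d → F' (insert i e)) :
    OddCover a F' := by
  classical
  obtain ⟨z, hz, hzF, hz1⟩ := H
  set zm := z.filter Fm with hzm
  -- Sets with both properties stay in `zm`.
  set zp := z.filter (fun T => ¬ Fm T) with hzp
  have hsum : zm + zp = z := Finsupp.filter_add_filter_not z Fm
  have hsm : ∀ T ∈ zm.support, T.card = d ∧ F T ∧ Fm T := by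
    intro T hT
    rw [hzm, Finsupp.support_filter, Finset.mem_filter] at hT
    exact ⟨(hzF T hT.1).1, (hzF T hT.1).2, hT.2⟩
  have hsp : ∀ T ∈ zp.support, T.card = d ∧ F T ∧ Fp T := by
    intro T hT
    rw [hzp, Finsupp.support_filter, Finset.mem_filter] at hT
    exact ⟨(hzF T hT.1).1, (hzF T hT.1).2, (hF T (hzF T hT.1).2).resolve_left hT.2⟩
  have hbd : IndexChain.boundary zm = IndexChain.boundary zp := by
    have h1 : IndexChain.boundary zm + IndexChain.boundary zp = 0 := by rw [← map_add, hsum, hz]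
    have h2 := IndexChain.add_self (IndexChain.boundary zp)
    exact add_right_cancel (h1.trans h2.symm)
  have hcone := IndexChain.boundary_cone i zp fun T hT => hi T (hsp T hT).2.1
  have hz' : zm + IndexChain.cone i (IndexChain.boundary zp) =
      z + IndexChain.boundary (IndexChain.cone i zp) := by
    rw [hcone, ← hsum, add_assoc, ← add_assoc zp zp, IndexChain.add_self, zero_add]
  refine ⟨zm + IndexChain.cone i (IndexChain.boundary zp), ?_, ?_, ?_⟩
  · rw [hz', map_add, hz, IndexChain.boundary_boundary, zero_add]
  · intro T hT
    rcases Finset.mem_union.1 (Finsupp.support_add hT) with hT | hT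
    · exact ⟨(hsm T hT).1, hm T (hsm T hT).2.2⟩
    · obtain ⟨e, he, rfl⟩ := IndexChain.exists_of_mem_support_cone hT
      obtain ⟨T', hT', j', hj', he'⟩ := IndexChain.exists_of_mem_support_boundary he
      -- The set `e` is a face of a removed set `T'`; as the two boundaries agree, it is also a face
      -- of a kept set `T`.
      rw [← hbd] at he
      obtain ⟨T, hT, j, hj, he⟩ := IndexChain.exists_of_mem_support_boundary he
      have hce : e.card + 1 = d := by
        rw [he, Finset.card_erase_add_one hj, (hsm T hT).1]
      have heT : e ⊆ T := he ▸ Finset.erase_subset _ _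
      refine ⟨?_, hnew T T' e (hsm T hT).2.2 (hsp T' hT').2.2 heT
        (he' ▸ Finset.erase_subset _ _) hce⟩
      rw [Finset.card_insert_of_notMem fun h => hi T (hsm T hT).2.1 (heT h), hce]
  · intro h hg
    rw [hz', map_add, hz1 h hg]
    conv_lhs => rw [IndexChain.eq_sum zp]
    simp only [map_sum, map_smul, IndexChain.cone_single, coneParity_boundary_single]
    rw [Finset.sum_eq_zero, add_zero]
    intro T hT
    obtain ⟨hc, hFT, hFp⟩ := hsp T hT
    obtain ⟨w, hw⟩ := hpos T hFp
    rw [hg.sum_inCone_eq_zero (by rw [Finset.card_insert_of_notMem (hi T hFT), hc]) hw, smul_zero]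

/-- The cycle is the boundary of `σ`: its facet cones form a complete fan, in which a generic
direction lies in exactly one cone. -/
lemma OddCover.of_positive_relation {F : Finset ℕ → Prop} (hσ : σ.card = d + 1)
    (hF : ∀ j ∈ σ, F (σ.erase j)) {μ : ℕ → ℝ} (hμ : ∑ j ∈ σ, μ j • a j = 0)
    (μ0 : ∀ j ∈ σ, 0 < μ j) (hspan : ∀ h, ∃ l : ℕ → ℝ, ∑ j ∈ σ, l j • a j = h) :
    OddCover a F := by
  refine ⟨IndexChain.boundary (Finsupp.single σ 1), IndexChain.boundary_boundary _, ?_, ?_⟩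
  · intro T hT
    obtain ⟨T', hT', j, hj, rfl⟩ := IndexChain.exists_of_mem_support_boundary hT
    obtain rfl : T' = σ := by
      by_contra hne
      rw [Finsupp.mem_support_iff, Finsupp.single_eq_of_ne hne] at hT'
      exact hT' rfl
    exact ⟨by rw [Finset.card_erase_of_mem hj]; omega, hF j hj⟩
  · intro h hg
    obtain ⟨l, hl⟩ := hspan h
    rw [coneParity_boundary_single]
    exact hg.sum_inCone_eq_one hσ hl hμ μ0

end Cones


/-! ## Separation by generic functionals -/

section Separation

variable {d : ℕ}

/-- The nongeneric vectors lie in countably many proper subspaces, a null set. -/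
lemma exists_generic (a : ℕ → Fin d → ℝ) {U : Set (Fin d → ℝ)} (hU : IsOpen U)
    (hne : U.Nonempty) : ∃ h ∈ U, Generic a h := by
  by_contra! H
  have hsub : U ⊆ ⋃ J : Finset ℕ, ⋃ _ : J.card < d,
      (Submodule.span ℝ (a '' (J : Set ℕ)) : Set (Fin d → ℝ)) := by
    intro h hh
    have := H h hh
    simp only [Generic, not_forall, not_not] at this
    obtain ⟨J, hJ, hmem⟩ := this
    exact Set.mem_iUnion₂.2 ⟨J, hJ, hmem⟩
  have hnull : MeasureTheory.volume (⋃ J : Finset ℕ, ⋃ _ : J.card < d,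
      (Submodule.span ℝ (a '' (J : Set ℕ)) : Set (Fin d → ℝ))) = 0 := by
    refine MeasureTheory.measure_iUnion_null fun J => MeasureTheory.measure_iUnion_null fun hJ => ?_
    refine MeasureTheory.Measure.addHaar_submodule _ _ fun htop => ?_
    classical
    have h1 := finrank_span_finset_le_card (R := ℝ) (J.image a)
    have h2 : (J.image a).card ≤ J.card := Finset.card_image_le
    rw [Set.finrank, Finset.coe_image, htop, finrank_top, Module.finrank_fin_fun] at h1
    omega
  exact (hU.measure_pos MeasureTheory.volume hne).ne' (MeasureTheory.measure_mono_null hsub hnull)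

lemma OddCover.mem_convexHull {a : ℕ → Fin d → ℝ} {F : Finset ℕ → Prop} (H : OddCover a F)
    {X : Set (Fin d → ℝ)} (hX : X.Finite) (hF : ∀ T, F T → ∃ y ∈ X, ∀ j ∈ T, 1 ≤ a j ⬝ᵥ y)
    {x : Fin d → ℝ} (hx : ∀ j, a j ⬝ᵥ x ≤ 1) : x ∈ convexHull ℝ X := by
  by_contra hnot
  obtain ⟨f, r, hf1, hf2⟩ := geometric_hahn_banach_closed_point (convex_convexHull ℝ X)
    (hX.isCompact_convexHull ℝ).isClosed hnot
  -- Finiteness of `X` makes the separating functionals an open set, so one of them is generic.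
  set U : Set (Fin d → ℝ) := ⋂ y ∈ X, {h | h ⬝ᵥ y < h ⬝ᵥ x} with hU
  have hopen : IsOpen U := hX.isOpen_biInter fun y _ =>
    isOpen_lt (continuous_id.dotProduct continuous_const)
      (continuous_id.dotProduct continuous_const)
  have hne : U.Nonempty := by
    refine ⟨fun j => f (Pi.single j 1), Set.mem_iInter₂.2 fun y hy => ?_⟩
    have hrep : ∀ y : Fin d → ℝ, (fun j => f (Pi.single j 1)) ⬝ᵥ y = f y := by
      intro y
      conv_rhs => rw [pi_eq_sum_univ' y]
      simp [dotProduct, map_sum, mul_comm]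
    simp only [Set.mem_ofPred_eq, hrep]
    exact (hf1 y (subset_convexHull ℝ X hy)).trans hf2
  obtain ⟨h, hh, hg⟩ := exists_generic a hopen hne
  obtain ⟨T, hT, l, l0, hl⟩ := H.exists_inCone hg
  obtain ⟨y, hy, hy1⟩ := hF T hT
  have hlt : h ⬝ᵥ y < h ⬝ᵥ x := Set.mem_iInter₂.1 hh y hy
  rw [← hl] at hlt
  simp only [sum_dotProduct, smul_dotProduct, smul_eq_mul] at hlt
  refine hlt.not_ge (Finset.sum_le_sum fun j hj => ?_)
  exact mul_le_mul_of_nonneg_left ((hx j).trans (hy1 j hj)) (l0 j hj)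

end Separation

/-! ## Simplices given by inequalities -/

section Simplex

variable {d : ℕ} {b : Fin (d + 1) → Fin d → ℝ}

lemma eq_zero_of_isBounded {ι : Type*} (b : ι → Fin d → ℝ)
    (hb : Bornology.IsBounded {x : Fin d → ℝ | ∀ j, b j ⬝ᵥ x ≤ 1}) {x : Fin d → ℝ}
    (hx : ∀ j, b j ⬝ᵥ x ≤ 0) : x = 0 := by
  by_contra hne
  obtain ⟨R, hR⟩ := hb.exists_norm_le
  have hR0 : 0 ≤ R := (norm_nonneg _).trans (hR 0 (by simp))
  have hpos : 0 < ‖x‖ := norm_pos_iff.2 hne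
  have h1 := hR (((R + 1) / ‖x‖) • x) (by
    intro j
    rw [dotProduct_smul, smul_eq_mul]
    have := mul_nonpos_of_nonneg_of_nonpos (show 0 ≤ (R + 1) / ‖x‖ by positivity) (hx j)
    linarith)
  rw [norm_smul, Real.norm_of_nonneg (by positivity), div_mul_cancel₀ _ hpos.ne'] at h1
  linarith

/-- The map `x ↦ (b j ⬝ᵥ x)_j` is injective, so by dimension its image is the hyperplane orthogonal
to a relation `μ`. By `hb` this hyperplane meets the nonpositive orthant only in `0`, which forces
all `μ j` to be nonzero and of equal sign. -/
lemma exists_positive_relation (hb : ∀ x : Fin d → ℝ, (∀ j, b j ⬝ᵥ x ≤ 0) → x = 0) :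
    ∃ μ : Fin (d + 1) → ℝ, (∀ j, 0 < μ j) ∧ ∑ j, μ j • b j = 0 ∧
      ∀ y : Fin (d + 1) → ℝ, μ ⬝ᵥ y = 0 → ∃ x, ∀ j, b j ⬝ᵥ x = y j := by
  have hdep : ¬ LinearIndependent ℝ b := by
    intro hi
    have := hi.fintype_card_le_finrank
    simp at this
  obtain ⟨μ, hμ, i₀, hi₀⟩ := Fintype.not_linearIndependent_iff.1 hdep
  set B : (Fin d → ℝ) →ₗ[ℝ] (Fin (d + 1) → ℝ) := (Matrix.of b).mulVecLin with hB
  have hBapp : ∀ x j, B x j = b j ⬝ᵥ x := fun x j => rfl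
  have hinj : Function.Injective B := by
    rw [← LinearMap.ker_eq_bot, LinearMap.ker_eq_bot']
    intro x hx
    exact hb x fun j => by rw [← hBapp, hx]; simp
  have hrel : ∀ x, μ ⬝ᵥ B x = 0 := by
    intro x
    have := congrArg (fun v => v ⬝ᵥ x) hμ
    simp only [sum_dotProduct, smul_dotProduct, smul_eq_mul, zero_dotProduct] at this
    exact this
  set φ : (Fin (d + 1) → ℝ) →ₗ[ℝ] ℝ := dotProductBilin ℝ ℝ μ with hφ
  have hφapp : ∀ y, φ y = μ ⬝ᵥ y := fun y => rfl
  have hφ0 : φ ≠ 0 := by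
    intro h0
    have := congrArg (fun g => g (Pi.single i₀ 1)) h0
    simp [hφapp] at this
    exact hi₀ this
  have hle : LinearMap.range B ≤ LinearMap.ker φ := by
    rintro _ ⟨x, rfl⟩
    exact hrel x
  have hrange : LinearMap.range B = LinearMap.ker φ := by
    refine Submodule.eq_of_le_of_finrank_eq hle ?_
    rw [LinearMap.finrank_range_of_inj hinj]
    have h1 := Module.Dual.finrank_ker_add_one_of_ne_zero (f := φ) hφ0
    simp at h1 ⊢
    omega
  have hsolve : ∀ y : Fin (d + 1) → ℝ, μ ⬝ᵥ y = 0 → ∃ x, ∀ j, b j ⬝ᵥ x = y j := by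
    intro y hy
    have : y ∈ LinearMap.range B := by rw [hrange]; exact hy
    obtain ⟨x, rfl⟩ := this
    exact ⟨x, fun j => rfl⟩
  have hnonpos : ∀ y : Fin (d + 1) → ℝ, μ ⬝ᵥ y = 0 → (∀ j, y j ≤ 0) → y = 0 := by
    intro y hy hy0
    obtain ⟨x, hx⟩ := hsolve y hy
    have := hb x fun j => by rw [hx]; exact hy0 j
    ext j
    rw [← hx, this]
    simp
  have hsame : ∀ i j, 0 < μ i * μ j := by
    have hne : ∀ i, μ i ≠ 0 := by
      intro i hi
      have := hnonpos (-Pi.single i 1) (by simp [hi]) (fun j => by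
        by_cases hij : j = i
        · subst hij; simp
        · simp [hij])
      have := congrFun this i
      simp at this
    intro i j
    by_contra hneg
    have hlt : μ i * μ j < 0 := lt_of_le_of_ne (not_lt.1 hneg) (mul_ne_zero (hne i) (hne j))
    have hij : i ≠ j := by
      rintro rfl
      exact hneg (mul_self_pos.2 (hne i))
    -- For opposite signs this vector is nonpositive, nonzero and orthogonal to `μ`.
    have := hnonpos (Pi.single i (-(μ j * μ j)) + Pi.single j (μ i * μ j))
      (by simp [dotProduct_add]; ring) (fun k => by
        have h1 : Pi.single (M := fun _ => ℝ) i (-(μ j * μ j)) k ≤ 0 := by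
          rw [Pi.single_apply]
          split_ifs
          · exact neg_nonpos.2 (mul_self_nonneg _)
          · exact le_rfl
        have h2 : Pi.single (M := fun _ => ℝ) j (μ i * μ j) k ≤ 0 := by
          rw [Pi.single_apply]
          split_ifs
          · exact hlt.le
          · exact le_rfl
        exact add_nonpos h1 h2)
    have := congrFun this i
    simp [hij, hne] at this
  refine ⟨fun j => μ i₀ * μ j, fun j => hsame i₀ j, ?_, ?_⟩
  · simp only [mul_smul, ← Finset.smul_sum, hμ, smul_zero]
  · intro y hy
    refine hsolve y ?_
    have : μ i₀ * (μ ⬝ᵥ y) = 0 := by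
      rw [← hy]
      simp [dotProduct, Finset.mul_sum, mul_assoc]
    exact (mul_eq_zero.1 this).resolve_left hi₀

/-- Dual to injectivity of `x ↦ (b j ⬝ᵥ x)_j`: the coefficients are `h` composed with a left
inverse. -/
lemma exists_combination (hb : ∀ x : Fin d → ℝ, (∀ j, b j ⬝ᵥ x ≤ 0) → x = 0)
    (h : Fin d → ℝ) : ∃ l : Fin (d + 1) → ℝ, ∑ j, l j • b j = h := by
  have hker : LinearMap.ker (Matrix.of b).mulVecLin = ⊥ := LinearMap.ker_eq_bot'.2 fun x hx =>
    hb x fun j => (congrFun hx j).le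
  obtain ⟨g, hg⟩ := LinearMap.exists_leftInverse_of_injective _ hker
  refine ⟨fun j => h ⬝ᵥ g (Pi.single j 1), dotProduct_eq _ _ fun x => ?_⟩
  have hx : g ((Matrix.of b).mulVecLin x) = x := LinearMap.congr_fun hg x
  conv_rhs => rw [← hx, pi_eq_sum_univ' ((Matrix.of b).mulVecLin x)]
  simp only [sum_dotProduct, smul_dotProduct, smul_eq_mul, map_sum, map_smul, dotProduct_sum,
    dotProduct_smul]
  exact Finset.sum_congr rfl fun j _ => mul_comm _ _

lemma exists_vertices (hb : ∀ x : Fin d → ℝ, (∀ j, b j ⬝ᵥ x ≤ 0) → x = 0) {t : ℝ}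
    (ht : 0 < t) : ∃ u : Fin (d + 1) → Fin d → ℝ, (∀ i j, j ≠ i → b j ⬝ᵥ u i = t) ∧
      Set.BijOn u Set.univ (Set.extremePoints ℝ {x | ∀ j, b j ⬝ᵥ x ≤ t}) := by
  obtain ⟨μ, μ0, hμ, hsolve⟩ := exists_positive_relation hb
  have hrel : ∀ x, ∑ j, μ j * (b j ⬝ᵥ x) = 0 := by
    intro x
    have := congrArg (fun v => v ⬝ᵥ x) hμ
    simpa [sum_dotProduct, smul_dotProduct] using this
  have hext : ∀ x x' : Fin d → ℝ, (∀ j, b j ⬝ᵥ x = b j ⬝ᵥ x') → x = x' := by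
    intro x x' hxx
    exact sub_eq_zero.1 (hb _ fun j => by rw [dotProduct_sub, hxx, sub_self])
  have hext' : ∀ (i : Fin (d + 1)) (x x' : Fin d → ℝ), (∀ j, j ≠ i → b j ⬝ᵥ x = b j ⬝ᵥ x') →
      x = x' := by
    intro i x x' hxx
    refine hext x x' fun j => ?_
    by_cases hji : j = i
    · subst hji
      have h1 := hrel x
      have h2 := hrel x'
      rw [← Finset.add_sum_erase _ _ (Finset.mem_univ j)] at h1 h2
      rw [Finset.sum_congr rfl fun k hk => by rw [hxx k (Finset.ne_of_mem_erase hk)]] at h1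
      have h3 : μ j * (b j ⬝ᵥ x) = μ j * (b j ⬝ᵥ x') := by linarith
      exact mul_left_cancel₀ (μ0 j).ne' h3
    · exact hxx j hji
  set M := ∑ j, μ j with hM
  have hMpos : 0 < M := Finset.sum_pos (fun j _ => μ0 j) Finset.univ_nonempty
  -- The slack of inequality `i` at the opposite vertex, dictated by the relation `μ`. The quotients
  -- `(t - b i ⬝ᵥ x) / s i` are then the barycentric coordinates of `x`.
  set s : Fin (d + 1) → ℝ := fun i => t * M / μ i with hs
  have s0 : ∀ i, 0 < s i := fun i => div_pos (mul_pos ht hMpos) (μ0 i)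
  have hu : ∀ i, ∃ x, ∀ j, b j ⬝ᵥ x = t - (if j = i then s i else 0) := by
    intro i
    refine hsolve _ ?_
    have := (μ0 i).ne'
    simp only [dotProduct, mul_sub, Finset.sum_sub_distrib, ← Finset.sum_mul, mul_ite, mul_zero,
      Finset.sum_ite_eq', Finset.mem_univ, if_true]
    rw [← hM, hs]
    field_simp
    ring
  choose u hu using hu
  have hne : ∀ i j, j ≠ i → b j ⬝ᵥ u i = t := fun i j hj => by simp [hu, hj]
  have hself : ∀ i, b i ⬝ᵥ u i = t - s i := fun i => by simp [hu]
  have hmem : ∀ i j, b j ⬝ᵥ u i ≤ t := by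
    intro i j
    rw [hu]
    split_ifs
    · linarith [s0 i]
    · simp
  have hcv : Convex ℝ {x : Fin d → ℝ | ∀ j, b j ⬝ᵥ x ≤ t} := by
    intro x hx y hy p q hp hq hpq j
    rw [dotProduct_add, dotProduct_smul, dotProduct_smul, smul_eq_mul, smul_eq_mul]
    calc p * (b j ⬝ᵥ x) + q * (b j ⬝ᵥ y) ≤ p * t + q * t :=
          add_le_add (mul_le_mul_of_nonneg_left (hx j) hp) (mul_le_mul_of_nonneg_left (hy j) hq)
      _ = t := by rw [← add_mul, hpq, one_mul]
  have hhull : {x : Fin d → ℝ | ∀ j, b j ⬝ᵥ x ≤ t} = convexHull ℝ (Set.range u) := by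
    refine Set.Subset.antisymm (fun x hx => ?_) (convexHull_min ?_ hcv)
    · have hw : ∑ i, (t - b i ⬝ᵥ x) / s i = 1 := by
        have : ∀ i, (t - b i ⬝ᵥ x) / s i = (μ i * t - μ i * (b i ⬝ᵥ x)) / (t * M) := by
          intro i
          have := (μ0 i).ne'
          rw [hs]
          field_simp
        simp only [this, ← Finset.sum_div, Finset.sum_sub_distrib, hrel, ← Finset.sum_mul, ← hM]
        field_simp
        ring
      have hxe : x = ∑ i, ((t - b i ⬝ᵥ x) / s i) • u i := by
        refine hext _ _ fun j => ?_
        simp only [dotProduct_sum, dotProduct_smul, smul_eq_mul, hu, mul_sub,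
          Finset.sum_sub_distrib, ← Finset.sum_mul, hw, mul_ite, mul_zero, Finset.sum_ite_eq,
          Finset.mem_univ, if_true]
        have := (s0 j).ne'
        field_simp
        ring
      rw [hxe]
      exact (convex_convexHull ℝ _).sum_mem
        (fun i _ => div_nonneg (sub_nonneg.2 (hx i)) (s0 i).le) hw
        fun i _ => subset_convexHull ℝ _ ⟨i, rfl⟩
    · rintro _ ⟨i, rfl⟩
      exact hmem i
  refine ⟨u, hne, ?_, ?_, ?_⟩
  · intro i _
    rw [mem_extremePoints]
    refine ⟨hmem i, fun x hx y hy hxy => ?_⟩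
    obtain ⟨p, q, hp, hq, hpq, hxy⟩ := hxy
    -- An inequality active inside a segment of the polyhedron is active at both ends, and `d`
    -- active inequalities determine the point.
    have hface : ∀ j, j ≠ i → b j ⬝ᵥ x = t ∧ b j ⬝ᵥ y = t := by
      intro j hj
      have h1 : p * (b j ⬝ᵥ x) + q * (b j ⬝ᵥ y) = t := by
        rw [← hne i j hj, ← hxy, dotProduct_add, dotProduct_smul, dotProduct_smul, smul_eq_mul,
          smul_eq_mul]
      have h2 := hx j
      have h3 := hy j
      constructor
      · by_contra hlt
        have := mul_lt_mul_of_pos_left (lt_of_le_of_ne h2 hlt) hp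
        have := mul_le_mul_of_nonneg_left h3 hq.le
        have : p * t + q * t = t := by rw [← add_mul, hpq, one_mul]
        linarith
      · by_contra hlt
        have := mul_lt_mul_of_pos_left (lt_of_le_of_ne h3 hlt) hq
        have := mul_le_mul_of_nonneg_left h2 hp.le
        have : p * t + q * t = t := by rw [← add_mul, hpq, one_mul]
        linarith
    exact ⟨hext' i _ _ fun j hj => by rw [(hface j hj).1, hne i j hj],
      hext' i _ _ fun j hj => by rw [(hface j hj).2, hne i j hj]⟩
  · intro i _ k _ hik
    by_contra hne'
    have h1 := hself i
    rw [hik, hne k i hne'] at h1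
    linarith [s0 i]
  · rw [hhull]
    intro x hx
    obtain ⟨i, rfl⟩ := extremePoints_convexHull_subset hx
    exact ⟨i, Set.mem_univ i, rfl⟩

end Simplex


/-! ## Correctness of the approximate double description method -/

section Segments

variable {d : ℕ} {x y p : Fin d → ℝ}

lemma dotProduct_le_of_mem_segment (hp : p ∈ segment ℝ x y) {a : Fin d → ℝ} {t : ℝ}
    (hx : a ⬝ᵥ x ≤ t) (hy : a ⬝ᵥ y ≤ t) : a ⬝ᵥ p ≤ t := by
  obtain ⟨q, r, hq, hr, hqr, rfl⟩ := hp
  rw [dotProduct_add, dotProduct_smul, dotProduct_smul, smul_eq_mul, smul_eq_mul]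
  calc q * (a ⬝ᵥ x) + r * (a ⬝ᵥ y) ≤ q * t + r * t :=
        add_le_add (mul_le_mul_of_nonneg_left hx hq) (mul_le_mul_of_nonneg_left hy hr)
    _ = t := by rw [← add_mul, hqr, one_mul]

lemma le_dotProduct_of_mem_segment (hp : p ∈ segment ℝ x y) {a : Fin d → ℝ} {t : ℝ}
    (hx : t ≤ a ⬝ᵥ x) (hy : t ≤ a ⬝ᵥ y) : t ≤ a ⬝ᵥ p := by
  have := dotProduct_le_of_mem_segment hp (a := -a) (t := -t)
    (by rw [neg_dotProduct]; exact neg_le_neg hx) (by rw [neg_dotProduct]; exact neg_le_neg hy)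
  rw [neg_dotProduct] at this
  exact neg_le_neg_iff.1 this

lemma exists_mem_segment_dotProduct_eq {a : Fin d → ℝ} {t : ℝ} (hx : a ⬝ᵥ x < t)
    (hy : t < a ⬝ᵥ y) : ∃ p ∈ segment ℝ x y, a ⬝ᵥ p = t := by
  have hxy : 0 < a ⬝ᵥ y - a ⬝ᵥ x := by linarith
  refine ⟨((a ⬝ᵥ y - t) / (a ⬝ᵥ y - a ⬝ᵥ x)) • x + ((t - a ⬝ᵥ x) / (a ⬝ᵥ y - a ⬝ᵥ x)) • y,
    ⟨_, _, div_nonneg (by linarith) hxy.le, div_nonneg (by linarith) hxy.le, ?_, rfl⟩, ?_⟩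
  · field_simp
    ring
  · rw [dotProduct_add, dotProduct_smul, dotProduct_smul, smul_eq_mul, smul_eq_mul]
    field_simp
    ring

lemma convex_setOf_dotProduct_le (a : Fin d → ℝ) (t : ℝ) : Convex ℝ {x | a ⬝ᵥ x ≤ t} :=
  convex_iff_segment_subset.2 fun _ hx _ hy _ hp => dotProduct_le_of_mem_segment hp hx hy

end Segments

/-! ### Rows indexed by natural numbers, and the first simplex -/

section Rows

variable {m d : ℕ} (A : Matrix (Fin m) (Fin d) ℝ)

/-- The rows of `A`, extended by zero. -/
def row (j : ℕ) : Fin d → ℝ := if h : j < m then A ⟨j, h⟩ else 0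

@[simp]
lemma row_val (i : Fin m) : row A i = A i := by simp [row]

variable {A} {ε : ℝ}

/-- The rows of the first simplex. -/
def ValidInput.cornerRow (h : ValidInput A ε) (j : Fin (d + 1)) : Fin d → ℝ :=
  A (Fin.castLE h.rows j)

lemma ValidInput.cornerRow_eq (h : ValidInput A ε) (j : Fin (d + 1)) :
    h.cornerRow j = row A j :=
  (row_val A (Fin.castLE h.rows j)).symm

lemma ValidInput.corner_eq (h : ValidInput A ε) (t : ℝ) :
    corner A t = {x | ∀ j, h.cornerRow j ⬝ᵥ x ≤ t} := by
  ext x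
  constructor
  · exact fun hx j => hx _ (Nat.lt_succ_iff.1 j.2)
  · exact fun hx i hi => hx ⟨i, Nat.lt_succ_iff.2 hi⟩

lemma ValidInput.eq_zero (h : ValidInput A ε) (x : Fin d → ℝ)
    (hx : ∀ j, h.cornerRow j ⬝ᵥ x ≤ 0) : x = 0 := by
  refine eq_zero_of_isBounded h.cornerRow ?_ hx
  rw [← h.corner_eq]
  obtain ⟨p, -, hp⟩ := h.simplex
  rw [hp]
  exact isBounded_convexHull.2 (Set.finite_range p).isBounded

lemma ValidInput.exists_vertexLabelling (h : ValidInput A ε) : ∃ u, IsVertexLabelling A ε u := by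
  obtain ⟨u, hu, hbij⟩ := exists_vertices h.eq_zero (t := 1 + ε / 2)
    (by linarith [h.tolerance])
  refine ⟨u, by rwa [h.corner_eq], fun i j hj hji => ?_⟩
  exact hu i ⟨j, Nat.lt_succ_iff.2 hj⟩ fun he => hji (congrArg Fin.val he)

lemma ValidInput.oddCover (h : ValidInput A ε) {F : Finset ℕ → Prop}
    (hF : ∀ j ∈ Finset.range (d + 1), F ((Finset.range (d + 1)).erase j)) :
    OddCover (row A) F := by
  obtain ⟨μ, μ0, hμ, -⟩ := exists_positive_relation h.eq_zero
  have hsum : ∀ l : Fin (d + 1) → ℝ, ∑ j ∈ Finset.range (d + 1),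
      (if hj : j < d + 1 then l ⟨j, hj⟩ else 0) • row A j = ∑ j, l j • h.cornerRow j := by
    intro l
    rw [Finset.sum_range]
    exact Finset.sum_congr rfl fun j _ => by rw [dif_pos j.2, h.cornerRow_eq]
  refine OddCover.of_positive_relation (Finset.card_range _) hF ((hsum μ).trans hμ) ?_ ?_
  · intro j hj
    rw [Finset.mem_range] at hj
    simp [hj, μ0]
  · intro v
    obtain ⟨l, hl⟩ := exists_combination h.eq_zero v
    exact ⟨_, (hsum l).trans hl⟩

end Rows

/-! ### The invariant, its preservation, and total correctness -/

namespace DDM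

variable {m d : ℕ} {A : Matrix (Fin m) (Fin d) ℝ} {ε : ℝ}

/-- The invariant that holds after the iterations of the rows before `k`. -/
structure Invariant (A : Matrix (Fin m) (Fin d) ℝ) (ε : ℝ) (k : ℕ) (s : State d) : Prop where
  finite : s.V.Finite
  fresh : ∀ j u w, Node.cut j u w ∈ s.V → j < k
  incident_lt : ∀ v ∈ s.V, ∀ j ∈ s.I v, j < k
  active : ∀ v ∈ s.V, ∀ j ∈ s.I v, 1 ≤ row A j ⬝ᵥ s.c v
  le : ∀ v ∈ s.V, ∀ j : Fin m, (j : ℕ) < k → A j ⬝ᵥ s.c v ≤ 1 + ε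
  edges : ∀ u ∈ s.V, ∀ w ∈ s.V, u ≠ w → d - 1 ≤ (s.I u ∩ s.I w).card → s(u, w) ∈ s.E
  cover : OddCover (row A) fun T => ∃ v ∈ s.V, T ⊆ s.I v

lemma IsInitial.invariant {s : State d} (hA : ValidInput A ε) (h : IsInitial A ε s) :
    Invariant A ε (d + 1) s where
  finite := by rw [h.nodes]; exact Set.finite_range _
  fresh j u w hv := by
    rw [h.nodes] at hv
    obtain ⟨i, hi⟩ := hv
    cases hi
  incident_lt v hv j hj := by
    rw [h.nodes] at hv
    obtain ⟨i, rfl⟩ := hv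
    rw [h.incidence] at hj
    exact Finset.mem_range.1 (Finset.mem_of_mem_erase hj)
  active v hv j hj := by
    rw [h.nodes] at hv
    obtain ⟨i, rfl⟩ := hv
    rw [h.incidence, Finset.mem_erase, Finset.mem_range] at hj
    have h1 := h.coords.2 i ⟨j, hj.2.trans_le hA.rows⟩ (Nat.lt_succ_iff.1 hj.2) hj.1
    have h2 : row A j = A ⟨j, hj.2.trans_le hA.rows⟩ := row_val A ⟨j, _⟩
    rw [h2, h1]
    linarith [hA.tolerance]
  le v hv j hj := by
    rw [h.nodes] at hv
    obtain ⟨i, rfl⟩ := hv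
    have h1 := (h.coords.1.mapsTo (Set.mem_univ i)).1 j (Nat.lt_succ_iff.1 hj)
    exact h1.trans (by linarith [hA.tolerance])
  edges u hu w hw huw _ := by
    rw [h.nodes] at hu hw
    obtain ⟨i, rfl⟩ := hu
    obtain ⟨j, rfl⟩ := hw
    rw [h.edges]
    exact ⟨i, j, fun he => huw (congrArg _ he), rfl⟩
  cover := by
    refine hA.oddCover fun j hj => ?_
    refine ⟨Node.init ⟨j, Finset.mem_range.1 hj⟩, ?_, ?_⟩
    · rw [h.nodes]
      exact ⟨_, rfl⟩
    · rw [h.incidence]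

/-- Available after every iteration, not only the last: it also shows that the method cannot get
stuck. -/
lemma Invariant.subset_convexHull {k : ℕ} {s : State d} (h : Invariant A ε k s) :
    polyhedron A 1 ⊆ convexHull ℝ (s.c '' s.V) := by
  intro x hx
  refine h.cover.mem_convexHull (h.finite.image _) ?_ fun j => ?_
  · rintro T ⟨v, hv, hT⟩
    exact ⟨_, ⟨v, hv, rfl⟩, fun j hj => h.active v hv j (hT hj)⟩
  · by_cases hj : j < m
    · simpa [row, hj] using hx ⟨j, hj⟩
    -- Beyond the matrix the row is zero, and `0 ≤ 1`.
    · simp [row, hj]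

lemma Invariant.isApproxVRep {s : State d} (h : Invariant A ε m s) :
    IsApproxVRep A ε (s.c '' s.V) := by
  refine ⟨h.subset_convexHull, fun x hx i => ?_⟩
  refine convexHull_min ?_ (convex_setOf_dotProduct_le (A i) (1 + ε)) hx
  rintro _ ⟨v, hv, rfl⟩
  exact h.le v hv i i.2

lemma Invariant.exists_isPartition (hA : ValidInput A ε) {s : State d} {i : Fin m}
    (h : Invariant A ε i s) : ∃ Vm V0 Vp, IsPartition A ε i s.V s.c Vm V0 Vp := by
  have hε := hA.tolerance
  refine ⟨{v ∈ s.V | A i ⬝ᵥ s.c v < 1 + ε / 2}, {v ∈ s.V | A i ⬝ᵥ s.c v = 1 + ε / 2},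
    {v ∈ s.V | 1 + ε / 2 < A i ⬝ᵥ s.c v}, ?_, ?_, ?_, ?_, ?_, fun v hv => hv.2,
    fun v hv => hv.2, fun v hv => ⟨by linarith [hv.2], by linarith [hv.2]⟩⟩
  · ext v
    constructor
    · rintro ((hv | hv) | hv) <;> exact hv.1
    · intro hv
      rcases lt_trichotomy (A i ⬝ᵥ s.c v) (1 + ε / 2) with h1 | h1 | h1
      · exact Or.inl (Or.inl ⟨hv, h1⟩)
      · exact Or.inl (Or.inr ⟨hv, h1⟩)
      · exact Or.inr ⟨hv, h1⟩
  · exact Set.disjoint_left.2 fun v h1 h2 => h1.2.ne h2.2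
  · exact Set.disjoint_left.2 fun v h1 h2 => lt_asymm h1.2 h2.2
  · exact Set.disjoint_left.2 fun v h1 h2 => h2.2.ne' h1.2
  -- If `V_-` were empty, `conv c(V)` would lie where row `i` is at least `1 + ε / 2 > 0`, yet it
  -- contains `0 ∈ P`.
  · by_contra hemp
    have h0 : (0 : Fin d → ℝ) ∈ convexHull ℝ (s.c '' s.V) :=
      h.subset_convexHull fun i => by simp
    have h1 : convexHull ℝ (s.c '' s.V) ⊆ {x | (-A i) ⬝ᵥ x ≤ -(1 + ε / 2)} := by
      refine convexHull_min ?_ (convex_setOf_dotProduct_le _ _)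
      rintro _ ⟨v, hv, rfl⟩
      have : ¬ A i ⬝ᵥ s.c v < 1 + ε / 2 := fun hlt => hemp ⟨v, hv, hlt⟩
      simp only [Set.mem_ofPred_eq, neg_dotProduct]
      linarith
    have h2 : (-A i) ⬝ᵥ (0 : Fin d → ℝ) ≤ -(1 + ε / 2) := h1 h0
    simp only [dotProduct_zero] at h2
    linarith

lemma Invariant.exists_update (hA : ValidInput A ε) {s : State d} {i : Fin m}
    (h : Invariant A ε i s) {Vm V0 Vp : Set (Node d)}
    (hp : IsPartition A ε i s.V s.c Vm V0 Vp) : ∃ s', Update A ε i s Vm V0 Vp s' := by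
  classical
  have hε := hA.tolerance
  have hpt : ∀ u w, ∃ p : Fin d → ℝ, u ∈ Vm → w ∈ Vp →
      p ∈ segment ℝ (s.c u) (s.c w) ∧ A i ⬝ᵥ p = 1 + ε / 2 := by
    intro u w
    by_cases huw : u ∈ Vm ∧ w ∈ Vp
    · obtain ⟨p, hp1, hp2⟩ := exists_mem_segment_dotProduct_eq (hp.minus u huw.1)
        (hp.plus w huw.2)
      exact ⟨p, fun _ _ => ⟨hp1, hp2⟩⟩
    · exact ⟨0, fun hu hw => (huw ⟨hu, hw⟩).elim⟩
  choose p hpt using hpt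
  -- New nodes are not old ones, so their coordinates and incidence sets can be prescribed freely.
  have hcut : ∀ u w, Node.cut i u w ∉ s.V := fun u w hv => lt_irrefl _ (h.fresh _ _ _ hv)
  have hVm : Vm ⊆ s.V := fun v hv => hp.union ▸ Or.inl (Or.inl hv)
  have hV0 : V0 ⊆ s.V := fun v hv => hp.union ▸ Or.inl (Or.inr hv)
  let c' : Node d → (Fin d → ℝ) := fun v => if v ∈ s.V then s.c v else
    match v with
    | .init _ => 0
    | .cut _ u w => p u w
  let I' : Node d → Finset ℕ := fun v => if v ∈ Vm then s.I v else
    if v ∈ V0 then insert (i : ℕ) (s.I v) else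
    match v with
    | .init _ => ∅
    | .cut _ u w => insert (i : ℕ) (s.I u ∩ s.I w)
  let V' : Set (Node d) := Vm ∪ V0 ∪ newNodes i s.E Vm Vp
  refine ⟨⟨V', {e | ∃ u ∈ V', ∃ w ∈ V', u ≠ w ∧ e = s(u, w) ∧ d - 1 ≤ (I' u ∩ I' w).card},
    I', c'⟩, ⟨fun v hv => if_pos hv, fun u hu w hw _ => ?_⟩, fun v hv => if_pos hv,
    fun v hv => ?_, fun u hu w hw _ => ?_, rfl, rfl⟩
  · have hc : c' (Node.cut i u w) = p u w := if_neg (hcut u w)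
    obtain ⟨h1, h2⟩ := hpt u w hu hw
    change c' _ ∈ _ ∧ 1 ≤ A i ⬝ᵥ c' _ ∧ A i ⬝ᵥ c' _ ≤ _
    rw [hc, h2]
    exact ⟨h1, by linarith, by linarith⟩
  · change I' v = _
    have hv' : v ∉ Vm := fun hm => Set.disjoint_left.1 hp.disj_m0 hm hv
    simp only [I', if_neg hv', if_pos hv]
  · change I' _ = _
    have h1 : Node.cut i u w ∉ Vm := fun hm => hcut u w (hVm hm)
    have h2 : Node.cut i u w ∉ V0 := fun hm => hcut u w (hV0 hm)
    simp only [I', if_neg h1, if_neg h2]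

lemma Invariant.update (hA : ValidInput A ε) {s s' : State d} {i : Fin m}
    (h : Invariant A ε i s) {Vm V0 Vp : Set (Node d)}
    (hp : IsPartition A ε i s.V s.c Vm V0 Vp) (hu : Update A ε i s Vm V0 Vp s') :
    Invariant A ε (i + 1) s' := by
  have hε := hA.tolerance
  have hVm : Vm ⊆ s.V := fun v hv => hp.union ▸ Or.inl (Or.inl hv)
  have hV0 : V0 ⊆ s.V := fun v hv => hp.union ▸ Or.inl (Or.inr hv)
  have hVp : Vp ⊆ s.V := fun v hv => hp.union ▸ Or.inr hv
  have hcases : ∀ v ∈ s'.V, v ∈ Vm ∨ v ∈ V0 ∨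
      ∃ u ∈ Vm, ∃ w ∈ Vp, s(u, w) ∈ s.E ∧ v = Node.cut i u w := by
    intro v hv
    rw [hu.nodes] at hv
    rcases hv with (hv | hv) | hv
    exacts [Or.inl hv, Or.inr (Or.inl hv), Or.inr (Or.inr hv)]
  refine ⟨?_, ?_, ?_, ?_, ?_, ?_, ?_⟩
  · rw [hu.nodes]
    refine ((h.finite.subset hVm).union (h.finite.subset hV0)).union
      (((h.finite.prod h.finite).image fun x => Node.cut i x.1 x.2).subset ?_)
    rintro v ⟨u, hu, w, hw, -, rfl⟩
    exact ⟨(u, w), ⟨hVm hu, hVp hw⟩, rfl⟩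
  · intro j x y hv
    rcases hcases _ hv with hv | hv | ⟨u, -, w, -, -, he⟩
    · exact (h.fresh _ _ _ (hVm hv)).trans (Nat.lt_succ_self _)
    · exact (h.fresh _ _ _ (hV0 hv)).trans (Nat.lt_succ_self _)
    · cases he
      exact Nat.lt_succ_self _
  · intro v hv j hj
    rcases hcases _ hv with hv | hv | ⟨u, hum, w, hwp, hE, rfl⟩
    · rw [hu.inc_minus v hv] at hj
      exact (h.incident_lt v (hVm hv) j hj).trans (Nat.lt_succ_self _)
    · rw [hu.inc_zero v hv, Finset.mem_insert] at hj
      rcases hj with rfl | hj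
      · exact Nat.lt_succ_self _
      · exact (h.incident_lt v (hV0 hv) j hj).trans (Nat.lt_succ_self _)
    · rw [hu.inc_new u hum w hwp hE, Finset.mem_insert, Finset.mem_inter] at hj
      rcases hj with rfl | hj
      · exact Nat.lt_succ_self _
      · exact (h.incident_lt u (hVm hum) j hj.1).trans (Nat.lt_succ_self _)
  · intro v hv j hj
    rcases hcases _ hv with hv | hv | ⟨u, hum, w, hwp, hE, rfl⟩
    · rw [hu.inc_minus v hv] at hj
      rw [hu.coords.1 (hVm hv)]
      exact h.active v (hVm hv) j hj
    · rw [hu.inc_zero v hv, Finset.mem_insert] at hj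
      rw [hu.coords.1 (hV0 hv)]
      rcases hj with rfl | hj
      · rw [row_val]
        exact (hp.zero v hv).1
      · exact h.active v (hV0 hv) j hj
    · rw [hu.inc_new u hum w hwp hE, Finset.mem_insert, Finset.mem_inter] at hj
      obtain ⟨h1, h2, -⟩ := hu.coords.2 u hum w hwp hE
      rcases hj with rfl | hj
      · rw [row_val]
        exact h2
      -- A row incident with both ends is at least `1` at both, hence on the whole segment.
      · exact le_dotProduct_of_mem_segment h1 (h.active u (hVm hum) j hj.1)
          (h.active w (hVp hwp) j hj.2)
  · intro v hv j hj
    rcases Nat.lt_succ_iff_lt_or_eq.1 hj with hj | hj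
    · rcases hcases _ hv with hv | hv | ⟨u, hum, w, hwp, hE, rfl⟩
      · rw [hu.coords.1 (hVm hv)]
        exact h.le v (hVm hv) j hj
      · rw [hu.coords.1 (hV0 hv)]
        exact h.le v (hV0 hv) j hj
      · exact dotProduct_le_of_mem_segment (hu.coords.2 u hum w hwp hE).1
          (h.le u (hVm hum) j hj) (h.le w (hVp hwp) j hj)
    · obtain rfl : j = i := Fin.ext hj
      rcases hcases _ hv with hv | hv | ⟨u, hum, w, hwp, hE, rfl⟩
      · rw [hu.coords.1 (hVm hv)]
        linarith [hp.minus v hv]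
      · rw [hu.coords.1 (hV0 hv)]
        exact (hp.zero v hv).2
      · exact (hu.coords.2 u hum w hwp hE).2.2
  · intro u hu' w hw' hne hcard
    rw [hu.edges]
    exact ⟨u, hu', w, hw', hne, rfl, hcard⟩
  · refine h.cover.insert i (Fm := fun T => ∃ v ∈ Vm ∪ V0, T ⊆ s.I v)
      (Fp := fun T => ∃ v ∈ Vp, T ⊆ s.I v) ?_ ?_ ?_ ?_ ?_
    · rintro T ⟨v, hv, hT⟩
      rw [← hp.union] at hv
      exact hv.imp (fun hv => ⟨v, hv, hT⟩) fun hv => ⟨v, hv, hT⟩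
    · rintro T ⟨v, hv, hT⟩ hi
      exact lt_irrefl _ (h.incident_lt v hv i (hT hi))
    · rintro T ⟨v, hv, hT⟩
      -- The removed point itself is the witness: row `i` exceeds `1 + ε / 2` there, and incident
      -- rows are at least `1`.
      refine ⟨s.c v, fun j hj => ?_⟩
      rcases Finset.mem_insert.1 hj with rfl | hj
      · rw [row_val]
        linarith [hp.plus v hv]
      · exact one_pos.trans_le (h.active v (hVp hv) j (hT hj))
    · rintro T ⟨v, hv | hv, hT⟩
      · exact ⟨v, hu.nodes ▸ Or.inl (Or.inl hv), by rwa [hu.inc_minus v hv]⟩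
      · refine ⟨v, hu.nodes ▸ Or.inl (Or.inr hv), ?_⟩
        rw [hu.inc_zero v hv]
        exact hT.trans (Finset.subset_insert _ _)
    · rintro T T' e ⟨u, hum, hT⟩ ⟨w, hwp, hT'⟩ heT heT' hcard
      -- For `u ∈ V_-` the common `d - 1` incidences guarantee the edge that creates the new node;
      -- for `u ∈ V_0` the index `i` is added to `I(u)`, so no edge is needed.
      rcases hum with hum | hu0
      · have hsub : e ⊆ s.I u ∩ s.I w := Finset.subset_inter (heT.trans hT) (heT'.trans hT')
        have hne : u ≠ w := by
          rintro rfl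
          exact Set.disjoint_left.1 hp.disj_mp hum hwp
        have hE : s(u, w) ∈ s.E := h.edges u (hVm hum) w (hVp hwp) hne
          (le_trans (by omega) (Finset.card_le_card hsub))
        refine ⟨Node.cut i u w, hu.nodes ▸ Or.inr ⟨u, hum, w, hwp, hE, rfl⟩, ?_⟩
        rw [hu.inc_new u hum w hwp hE]
        exact Finset.insert_subset_insert _ hsub
      · refine ⟨u, hu.nodes ▸ Or.inl (Or.inr hu0), ?_⟩
        rw [hu.inc_zero u hu0]
        exact Finset.insert_subset_insert _ (heT.trans hT)

/-- The invariant of the configurations of the double description method. -/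
def ConfigInvariant (A : Matrix (Fin m) (Fin d) ℝ) (ε : ℝ) : Config d → Prop
  | .ready k s => k ≤ m ∧ Invariant A ε k s
  | .split k s Vm V0 Vp => ∃ i : Fin m, (i : ℕ) = k ∧ Invariant A ε k s ∧
      IsPartition A ε i s.V s.c Vm V0 Vp

lemma ConfigInvariant.of_step (hA : ValidInput A ε) {x y : Config d}
    (hx : ConfigInvariant A ε x) (hxy : Step A ε x y) : ConfigInvariant A ε y := by
  cases hxy with
  | partition i s Vm V0 Vp hp => exact ⟨i, rfl, hx.2, hp⟩
  | update i s s' Vm V0 Vp hu =>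
    obtain ⟨j, hj, hs, hp⟩ := hx
    obtain rfl : j = i := Fin.ext hj
    exact ⟨j.2, hs.update hA hp hu⟩

lemma ConfigInvariant.of_reachable (hA : ValidInput A ε) {x : Config d}
    (hx : (algorithm A ε).Reachable x) : ConfigInvariant A ε x := by
  obtain ⟨x₀, ⟨s, hs, rfl⟩, hx⟩ := hx
  induction hx with
  | refl => exact ⟨hA.rows, hs.invariant hA⟩
  | tail _ hstep ih => exact ih.of_step hA hstep

/-- The number of elementary steps, counted from the row with number zero. -/
def Config.progress : Config d → ℕ
  | .ready k _ => 2 * k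
  | .split k _ _ _ _ => 2 * k + 1

lemma Step.progress_eq {x y : Config d} (h : Step A ε x y) :
    y.progress = x.progress + 1 ∧ x.progress < 2 * m := by
  cases h with
  | partition i => exact ⟨rfl, by have := i.2; simp only [Config.progress]; omega⟩
  | update i => exact ⟨rfl, by have := i.2; simp only [Config.progress]; omega⟩

lemma exists_isInitial (hA : ValidInput A ε) : ∃ s : State d, IsInitial A ε s := by
  obtain ⟨u, hu⟩ := hA.exists_vertexLabelling
  exact ⟨⟨initNodes d, initEdges d,
    fun v => match v with
      | .init i => (Finset.range (d + 1)).erase i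
      | .cut _ _ _ => ∅,
    fun v => match v with
      | .init i => u i
      | .cut _ _ _ => 0⟩, rfl, rfl, fun _ => rfl, hu⟩

theorem correct (d : ℕ) : Correct d := by
  intro m A ε hA
  refine ⟨?_, ?_, ?_, ?_⟩
  · obtain ⟨s, hs⟩ := exists_isInitial hA
    exact ⟨_, s, hs, rfl⟩
  · intro x hx hnot
    have hinv := ConfigInvariant.of_reachable hA hx
    match x, hinv with
    | .ready k s, ⟨hk, hs⟩ =>
      have hlt : k < m := lt_of_le_of_ne hk fun he => hnot ⟨s, by rw [he]⟩
      obtain ⟨Vm, V0, Vp, hp⟩ := Invariant.exists_isPartition hA (i := ⟨k, hlt⟩) hs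
      exact ⟨_, Step.partition ⟨k, hlt⟩ s Vm V0 Vp hp⟩
    | .split _ s Vm V0 Vp, ⟨i, rfl, hs, hp⟩ =>
      obtain ⟨s', hs'⟩ := hs.exists_update hA hp
      exact ⟨_, Step.update i s s' Vm V0 Vp hs'⟩
  · rintro ⟨run, -, hrun⟩
    have hge : ∀ n, n ≤ (run n).progress := by
      intro n
      induction n with
      | zero => exact Nat.zero_le _
      | succ n ih => rw [(Step.progress_eq (hrun n)).1]; omega
    have h1 := hge (2 * m)
    have h2 := (Step.progress_eq (hrun (2 * m))).2
    omega
  · rintro _ hx - s rfl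
    exact (ConfigInvariant.of_reachable hA hx).2.isApproxVRep

end DDM

end ApproxVertexEnum

theorem mainTheorem3 (d : ℕ) (hd : d = 2 ∨ d = 3) :
    (ApproxVertexEnum.GA.Correct d → ApproxVertexEnum.DDM.Correct d) ∧
      ApproxVertexEnum.DDM.Correct d :=
  ⟨fun _ => ApproxVertexEnum.DDM.correct d, ApproxVertexEnum.DDM.correct d⟩
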